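/- Let $\mathbb K$ be $\mathbb R$ or $\mathbb C$ and let $X$ and $Y$ be Banach spaces over $\mathbb K$. Let $P(^2X,Y)$ be the space of bounded $2$-homogeneous polynomials $P:X\to Y$, i.e. of the maps $P(x)=B(x,x)$ with $B:X\times X\to Y$ bilinear that are bounded on the unit ball, with the norm $\|P\|=\sup\{\|P(x)\| : \|x\|\le 1\}$. For $P\in P(^2X,Y)$ let $S(x,x')=\tfrac12\bigl(P(x+x')-P(x)-P(x')\bigr)$ be the corresponding bounded symmetric bilinear map, and let $\overline S:X^{**}\times X^{**}\to Y^{**}$ be its extension given, for $z_1,z_2\in X^{**}$ and $y^*\in Y^*$, by $$\overline S(z_1,z_2)(y^*)=\Bigl\langle z_1,\ x\mapsto \bigl\langle z_2,\ x'\mapsto y^*(S(x,x'))\bigr\rangle\Bigr\rangle .$$ The Aron--Berner extension of $P$ is the polynomial $\overline P\in P(^2X^{**},Y^{**})$, $\overline P(z)=\overline S(z,z)$. It attains its norm if there is $z\in X^{**}$ with $\|z\|\le 1$ and $\|\overline P(z)\|=\|\overline P\|$. Theorem. The set of all $P\in P(^2X,Y)$ whose Aron--Berner extension $\overline P$ attains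 its norm is dense in $P(^2X,Y)$ with respect to the norm topology. -/

import Mathlib

set_option maxSynthPendingDepth 3

noncomputable section

namespace AronBerner

open Metric NormedSpace

section Polynomials

variable (𝕜 X Y : Type*) [RCLike 𝕜]
  [NormedAddCommGroup X] [NormedSpace 𝕜 X] [NormedAddCommGroup Y] [NormedSpace 𝕜 Y]

/-- The space `P(²X, Y)` of bounded `2`-homogeneous polynomials `P : X → Y`. A `2`-homogeneous
polynomial is a map of the form `x ↦ B (x, x)` with `B` bilinear, i.e. a quadratic map; it is
bounded if it is bounded on the unit ball, equivalently `‖P x‖ ≤ C ‖x‖ ^ 2` for some `C`. -/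
def HomPoly2 : Submodule 𝕜 (QuadraticMap 𝕜 X Y) where
  carrier := {P | ∃ C : ℝ, ∀ x, ‖P x‖ ≤ C * ‖x‖ ^ 2}
  zero_mem' := ⟨0, fun x => by simp⟩
  add_mem' := by
    rintro P Q ⟨C, hC⟩ ⟨D, hD⟩
    refine ⟨C + D, fun x => ?_⟩
    rw [add_apply, add_mul]
    exact (norm_add_le _ _).trans (add_le_add (hC x) (hD x))
  smul_mem' := by
    rintro c P ⟨C, hC⟩
    refine ⟨‖c‖ * C, fun x => ?_⟩
    rw [smul_apply, norm_smul, mul_assoc]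
    exact mul_le_mul_of_nonneg_left (hC x) (norm_nonneg c)

variable {𝕜 X Y}

/-- The supremum of `‖P x‖` over the closed unit ball. -/
def supNorm (P : HomPoly2 𝕜 X Y) : ℝ :=
  ⨆ x : closedBall (0 : X) 1, ‖P.1 x‖

theorem bddAbove_ball (P : HomPoly2 𝕜 X Y) :
    BddAbove (Set.range fun x : closedBall (0 : X) 1 => ‖P.1 x‖) := by
  obtain ⟨C, hC⟩ := P.2
  refine ⟨|C|, ?_⟩
  rintro _ ⟨⟨x, hx⟩, rfl⟩
  have hx1 : ‖x‖ ≤ 1 := by simpa using hx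
  calc ‖P.1 x‖ ≤ C * ‖x‖ ^ 2 := hC x
    _ ≤ |C| * ‖x‖ ^ 2 := mul_le_mul_of_nonneg_right (le_abs_self C) (by positivity)
    _ ≤ |C| * 1 := mul_le_mul_of_nonneg_left (pow_le_one₀ (norm_nonneg x) hx1) (abs_nonneg C)
    _ = |C| := mul_one _

theorem norm_apply_le_supNorm (P : HomPoly2 𝕜 X Y) {x : X} (hx : ‖x‖ ≤ 1) :
    ‖P.1 x‖ ≤ supNorm P :=
  le_ciSup (bddAbove_ball P) (⟨x, by simpa using hx⟩ : closedBall (0 : X) 1)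

theorem supNorm_nonneg (P : HomPoly2 𝕜 X Y) : 0 ≤ supNorm P :=
  (norm_nonneg (P.1 (0 : X))).trans (norm_apply_le_supNorm P (by simp))

theorem supNorm_le (P : HomPoly2 𝕜 X Y) {C : ℝ} (h : ∀ x : X, ‖x‖ ≤ 1 → ‖P.1 x‖ ≤ C) :
    supNorm P ≤ C := by
  have : Nonempty (closedBall (0 : X) 1) := ⟨⟨0, by simp⟩⟩
  exact ciSup_le fun x => h x (mem_closedBall_zero_iff.1 x.2)

theorem norm_apply_le (P : HomPoly2 𝕜 X Y) (x : X) : ‖P.1 x‖ ≤ supNorm P * ‖x‖ ^ 2 := by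
  rcases eq_or_ne x 0 with rfl | hx
  · simp
  have hx' : ‖x‖ ≠ 0 := norm_ne_zero_iff.2 hx
  have h1 : ‖((‖x‖ : 𝕜)⁻¹ • x)‖ ≤ 1 := by
    rw [norm_smul, norm_inv, RCLike.norm_ofReal, abs_norm, inv_mul_cancel₀ hx']
  have h2 := norm_apply_le_supNorm P h1
  rw [QuadraticMap.map_smul, norm_smul, norm_mul, norm_inv, RCLike.norm_ofReal, abs_norm] at h2
  have h3 : ‖P.1 x‖ = (‖x‖⁻¹ * ‖x‖⁻¹ * ‖P.1 x‖) * ‖x‖ ^ 2 := by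
    field_simp
  rw [h3]
  exact mul_le_mul_of_nonneg_right h2 (by positivity)

/-- `P(²X, Y)` is normed by `‖P‖ = sup {‖P x‖ : ‖x‖ ≤ 1}`. -/
instance : NormedAddCommGroup (HomPoly2 𝕜 X Y) :=
  AddGroupNorm.toNormedAddCommGroup
    { toFun := supNorm
      map_zero' := le_antisymm (supNorm_le _ fun x _ => by simp)
        (supNorm_nonneg 0)
      add_le' := fun P Q => supNorm_le _ fun x hx =>
        (norm_add_le (P.1 x) (Q.1 x)).trans
          (add_le_add (norm_apply_le_supNorm P hx) (norm_apply_le_supNorm Q hx))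
      neg' := fun P => by
        unfold supNorm
        simp
      eq_zero_of_map_eq_zero' := fun P hP => by
        ext x
        have h := norm_apply_le P x
        rw [hP, zero_mul] at h
        simpa using h }

theorem norm_def (P : HomPoly2 𝕜 X Y) : ‖P‖ = ⨆ x : closedBall (0 : X) 1, ‖P.1 x‖ := rfl

/-- `P` attains its norm: the supremum defining `‖P‖` is attained on the closed unit ball. -/
def AttainsNorm (P : HomPoly2 𝕜 X Y) : Prop :=
  ∃ x : X, ‖x‖ ≤ 1 ∧ ‖P.1 x‖ = ‖P‖

/-- The polynomial `x ↦ B (x, x)` of a bounded bilinear map `B`. -/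
def ofBilin (B : X →L[𝕜] X →L[𝕜] Y) : HomPoly2 𝕜 X Y :=
  ⟨LinearMap.BilinMap.toQuadraticMap (B.toLinearMap₁₂), ‖B‖, fun x => by
    rw [pow_two, ← mul_assoc]
    exact B.le_opNorm₂ x x⟩

@[simp] theorem ofBilin_apply (B : X →L[𝕜] X →L[𝕜] Y) (x : X) : (ofBilin B).1 x = B x x := rfl

theorem symBilin_bound (P : HomPoly2 𝕜 X Y) :
    ∃ C : ℝ, ∀ x y, ‖((2 : 𝕜)⁻¹ • P.1.polarBilin) x y‖ ≤ C * ‖x‖ * ‖y‖ := by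
  set M := ‖P‖ with hM
  have hM0 : 0 ≤ M := norm_nonneg P
  have hunit : ∀ x y : X, ‖x‖ ≤ 1 → ‖y‖ ≤ 1 → ‖P.1.polarBilin x y‖ ≤ 6 * M := by
    intro x y hx hy
    have h1 : ‖P.1 (x + y)‖ ≤ M * ‖x + y‖ ^ 2 := norm_apply_le P _
    have h2 : ‖P.1 x‖ ≤ M := norm_apply_le_supNorm P hx
    have h3 : ‖P.1 y‖ ≤ M := norm_apply_le_supNorm P hy
    have h4 : ‖x + y‖ ^ 2 ≤ 2 ^ 2 :=
      pow_le_pow_left₀ (norm_nonneg _) ((norm_add_le x y).trans (by linarith)) 2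
    have h5 : M * ‖x + y‖ ^ 2 ≤ M * 2 ^ 2 := mul_le_mul_of_nonneg_left h4 hM0
    have h6 : ‖P.1 (x + y) - P.1 x - P.1 y‖ ≤ ‖P.1 (x + y)‖ + ‖P.1 x‖ + ‖P.1 y‖ :=
      (norm_sub_le _ _).trans (by linarith [norm_sub_le (P.1 (x + y)) (P.1 x)])
    rw [QuadraticMap.polarBilin_apply_apply, QuadraticMap.polar]
    linarith
  have hn : ∀ x : X, ‖((‖x‖ : 𝕜)⁻¹ • x)‖ ≤ 1 := by
    intro x
    rw [norm_smul, norm_inv, RCLike.norm_ofReal, abs_norm]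
    exact inv_mul_le_one
  refine ⟨3 * M, fun x y => ?_⟩
  rcases eq_or_ne x 0 with rfl | hx
  · simp
  rcases eq_or_ne y 0 with rfl | hy
  · simp
  have hx' : 0 < ‖x‖ := norm_pos_iff.2 hx
  have hy' : 0 < ‖y‖ := norm_pos_iff.2 hy
  have h := hunit _ _ (hn x) (hn y)
  rw [map_smul, map_smul, LinearMap.smul_apply, norm_smul, norm_smul, norm_inv, norm_inv,
    RCLike.norm_ofReal, RCLike.norm_ofReal, abs_norm, abs_norm] at h
  have h7 : ‖P.1.polarBilin x y‖ ≤ 6 * M * ‖x‖ * ‖y‖ := by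
    have h8 : ‖P.1.polarBilin x y‖
        = (‖y‖⁻¹ * (‖x‖⁻¹ * ‖P.1.polarBilin x y‖)) * (‖x‖ * ‖y‖) := by
      field_simp
    rw [h8, mul_assoc (6 * M)]
    exact mul_le_mul_of_nonneg_right h (by positivity)
  rw [LinearMap.smul_apply, LinearMap.smul_apply, norm_smul, norm_inv, RCLike.norm_ofNat]
  linarith

/-- The symmetric bounded bilinear map `S` corresponding to `P`,
`S (x, y) = (P (x + y) - P x - P y) / 2`. -/
def symBilin (P : HomPoly2 𝕜 X Y) : X →L[𝕜] X →L[𝕜] Y :=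
  LinearMap.mkContinuousOfExistsBound₂ ((2 : 𝕜)⁻¹ • P.1.polarBilin) (symBilin_bound P)

theorem symBilin_apply (P : HomPoly2 𝕜 X Y) (x y : X) :
    symBilin P x y = (2 : 𝕜)⁻¹ • (P.1 (x + y) - P.1 x - P.1 y) := rfl

theorem symBilin_comm (P : HomPoly2 𝕜 X Y) (x y : X) : symBilin P x y = symBilin P y x := by
  rw [symBilin_apply, symBilin_apply, add_comm x y, sub_right_comm]

theorem ofBilin_symBilin (P : HomPoly2 𝕜 X Y) : ofBilin (symBilin P) = P := by
  ext x
  have h : P.1 (x + x) = (4 : 𝕜) • P.1 x := by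
    rw [← two_smul 𝕜 x, QuadraticMap.map_smul]
    norm_num
  rw [ofBilin_apply, symBilin_apply, h]
  module

end Polynomials

section Extension

variable {𝕜 X Y : Type*} [RCLike 𝕜]
  [NormedAddCommGroup X] [NormedSpace 𝕜 X] [NormedAddCommGroup Y] [NormedSpace 𝕜 Y]

/-- For `z ∈ X**` and a bounded bilinear form `T`, the functional `x ↦ ⟨z, T (x, •)⟩` on `X`. -/
def contract (T : X →L[𝕜] X →L[𝕜] 𝕜) (z : StrongDual 𝕜 (StrongDual 𝕜 X)) : StrongDual 𝕜 X :=
  z.comp T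

/-- The extension to `X** × X**` of a bounded bilinear form `T` on `X × X`: apply `z₂` to the
second variable of `T`, and then `z₁` to the first one. -/
def extendForm (T : X →L[𝕜] X →L[𝕜] 𝕜) (z₁ z₂ : StrongDual 𝕜 (StrongDual 𝕜 X)) : 𝕜 :=
  z₁ (contract T z₂)

/-- The bounded bilinear form `y* ∘ L`. -/
def compForm (w : StrongDual 𝕜 Y) (L : X →L[𝕜] X →L[𝕜] Y) : X →L[𝕜] X →L[𝕜] 𝕜 :=
  (ContinuousLinearMap.compL 𝕜 X Y 𝕜 w).comp L

@[simp] theorem compForm_apply (w : StrongDual 𝕜 Y) (L : X →L[𝕜] X →L[𝕜] Y) (x x' : X) :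
    compForm w L x x' = w (L x x') := rfl

/-- The extension of a bounded bilinear map `L : X × X → Y` to a bounded bilinear map
`X** × X** → Y**`, given by `(z₁, z₂) ↦ (y* ↦ extendForm (y* ∘ L) z₁ z₂)`; see
`extendBilin_apply`. It is assembled from bounded operators, so that it is bounded. -/
def extendBilin (L : X →L[𝕜] X →L[𝕜] Y) :
    StrongDual 𝕜 (StrongDual 𝕜 X) →L[𝕜] StrongDual 𝕜 (StrongDual 𝕜 X) →L[𝕜]
      StrongDual 𝕜 (StrongDual 𝕜 Y) :=
  let F : StrongDual 𝕜 Y →L[𝕜] X →L[𝕜] StrongDual 𝕜 X :=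
    ((ContinuousLinearMap.compL 𝕜 X (X →L[𝕜] Y) (StrongDual 𝕜 X)).flip L).comp
      (ContinuousLinearMap.compL 𝕜 X Y 𝕜)
  let G : StrongDual 𝕜 (StrongDual 𝕜 X) →L[𝕜] StrongDual 𝕜 Y →L[𝕜] StrongDual 𝕜 X :=
    ((ContinuousLinearMap.compL 𝕜 (StrongDual 𝕜 Y) (X →L[𝕜] StrongDual 𝕜 X)
      (StrongDual 𝕜 X)).flip F).comp (ContinuousLinearMap.compL 𝕜 X (StrongDual 𝕜 X) 𝕜)
  ((ContinuousLinearMap.compL 𝕜 (StrongDual 𝕜 (StrongDual 𝕜 X))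
    (StrongDual 𝕜 Y →L[𝕜] StrongDual 𝕜 X) (StrongDual 𝕜 (StrongDual 𝕜 Y))).flip G).comp
      (ContinuousLinearMap.compL 𝕜 (StrongDual 𝕜 Y) (StrongDual 𝕜 X) 𝕜)

theorem extendBilin_apply (L : X →L[𝕜] X →L[𝕜] Y) (z₁ z₂ : StrongDual 𝕜 (StrongDual 𝕜 X))
    (w : StrongDual 𝕜 Y) : extendBilin L z₁ z₂ w = extendForm (compForm w L) z₁ z₂ := rfl

/-- The Aron-Berner extension `z ↦ S̄ (z, z)` in `P(²X**, Y**)` of `P ∈ P(²X, Y)`, where `S̄`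
extends the symmetric bilinear map `S` of `P`. -/
def aronBerner (P : HomPoly2 𝕜 X Y) :
    HomPoly2 𝕜 (StrongDual 𝕜 (StrongDual 𝕜 X)) (StrongDual 𝕜 (StrongDual 𝕜 Y)) :=
  ofBilin (extendBilin (symBilin P))

theorem aronBerner_apply (P : HomPoly2 𝕜 X Y) (z : StrongDual 𝕜 (StrongDual 𝕜 X))
    (w : StrongDual 𝕜 Y) :
    (aronBerner P).1 z w = extendForm (compForm w (symBilin P)) z z := rfl

/-- The Aron-Berner extension restricts to `P` on `X`. -/
theorem aronBerner_inclusion (P : HomPoly2 𝕜 X Y) (x : X) :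
    (aronBerner P).1 (NormedSpace.inclusionInDoubleDual 𝕜 X x)
      = NormedSpace.inclusionInDoubleDual 𝕜 Y (P.1 x) := by
  ext w
  change w ((ofBilin (symBilin P)).1 x) = w (P.1 x)
  rw [ofBilin_symBilin]

end Extension

end AronBerner

end

/-!
The proof is a Lindenstrauss-type iteration. Write `S` for the symmetric bilinear map of `P`.

Two facts bound things from above. First, passing to the Aron-Berner extension does not increase the
norm (`norm_aronBerner_le`): by Goldstine's theorem a value `aronBerner P z` is approximated by
values of `P` at averages of suitable points of the unit ball. Secondly, if `|f (P x)|` is nearly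
`‖P‖` for a functional `f` of norm at most one, then `|f (S (x, w))|` is not much larger than `‖P‖`
for any `w` in the unit ball (`norm_dual_symBilin_le`).

Adding to `P` a small multiple of `T (·, ·) P x`, where `x` nearly maximizes `‖P‖` and `T` is a
scalar form with `T (x, x) ≥ 0`, forces `|T (y, y)|` to be nearly at least `T (x, x)` at all
near-maximizers `y` of the new polynomial and of all polynomials sufficiently close to it
(`exists_perturbation`). At stage `n` this is done twice: with `T = f n ∘ S`, where `f n` norms
`P x`, and then, at a new point `x n`, with the square of a combination of the functionals
`f m ∘ S (x n, ·)`, `m ≤ n`, whose coefficients are unimodular. The polynomials of all stages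
converge to a polynomial `P`, close to the given one, with two properties
(`exists_nearly_norming_sequences`): `|f m (P (x k))| ≥ ‖P‖ - 4⁻ᵐ` for `m ≤ k`, and the sum over
`m ≤ k` of `|f m (S (x k, x j))|` is at least that of `|f m (P (x k))|`, up to `1`, for `k < j`.

Let `z` be the weak-star limit of `x k` along an ultrafilter, so that `f m` takes at `aronBerner P z`
the value `lim_k lim_j f m (S (x k, x j))`. If `‖aronBerner P z‖` were smaller than `‖P‖`, then for
arbitrarily many `m` the quantities `|f m (S (x k, z))|` with `k` large would fall short of `‖P‖` by
a fixed amount. Since these quantities exceed `‖P‖` only by amounts that are summable in `m`, their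
sum over `m ≤ k` would fall short of `(k + 1) ‖P‖` by an arbitrarily large amount, which the second
property excludes (`attainsNorm_aronBerner_of_sequences`). Hence
`‖aronBerner P z‖ ≥ ‖P‖ ≥ ‖aronBerner P‖`.
-/

namespace AronBerner

open Metric NormedSpace Filter Topology

/-! ### Unimodular scalars -/

theorem exists_norm_add_mul_eq {𝕜 : Type*} [RCLike 𝕜] (a b : 𝕜) :
    ∃ c : 𝕜, ‖c‖ = 1 ∧ ‖a + c * b‖ = ‖a‖ + ‖b‖ := by
  rcases eq_or_ne a 0 with rfl | ha
  · exact ⟨1, by simp, by simp⟩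
  rcases eq_or_ne b 0 with rfl | hb
  · exact ⟨1, by simp, by simp⟩
  have ha' : (‖a‖ : 𝕜) ≠ 0 := by simpa using ha
  have hb' : (‖b‖ : 𝕜) ≠ 0 := by simpa using hb
  refine ⟨a / ‖a‖ * (‖b‖ / b), by simp [ha, hb], ?_⟩
  have h : a + a / ‖a‖ * (‖b‖ / b) * b = a / ‖a‖ * ((‖a‖ + ‖b‖ : ℝ) : 𝕜) := by
    push_cast
    field_simp
  rw [h, norm_mul, norm_div, RCLike.norm_ofReal, RCLike.norm_ofReal, abs_norm,
    div_self (norm_ne_zero_iff.2 ha), one_mul, abs_of_nonneg (by positivity)]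

theorem exists_norm_eq_one_mul_eq_norm {𝕜 : Type*} [RCLike 𝕜] (a : 𝕜) :
    ∃ c : 𝕜, ‖c‖ = 1 ∧ c * a = (‖a‖ : 𝕜) := by
  rcases eq_or_ne a 0 with rfl | ha
  · exact ⟨1, by simp, by simp⟩
  · exact ⟨‖a‖ / a, by simp [ha], by field_simp⟩

section

variable {𝕜 X Y : Type*} [RCLike 𝕜]
  [NormedAddCommGroup X] [NormedSpace 𝕜 X] [NormedAddCommGroup Y] [NormedSpace 𝕜 Y]

/-! ### The norm of the Aron-Berner extension -/

/-- **Goldstine's theorem**: on finitely many functionals, an element of the unit ball of `X**` is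
approximated by elements of the unit ball of `X`. -/
theorem exists_norm_le_one_forall_norm_sub_lt (z : StrongDual 𝕜 (StrongDual 𝕜 X)) (hz : ‖z‖ ≤ 1)
    (s : Finset (StrongDual 𝕜 X)) {ε : ℝ} (hε : 0 < ε) :
    ∃ x : X, ‖x‖ ≤ 1 ∧ ∀ φ ∈ s, ‖φ x - z φ‖ < ε := by
  classical
  let Φ : X →L[𝕜] (s → 𝕜) := ContinuousLinearMap.pi fun φ => φ.1
  let v : s → 𝕜 := fun φ => z φ.1
  let K : Set (s → 𝕜) := Φ '' closedBall 0 1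
  have hK : Convex ℝ K := by
    rintro _ ⟨x, hx, rfl⟩ _ ⟨y, hy, rfl⟩ a b ha hb hab
    refine ⟨(a : 𝕜) • x + (b : 𝕜) • y, ?_, ?_⟩
    · rw [mem_closedBall_zero_iff] at *
      calc ‖(a : 𝕜) • x + (b : 𝕜) • y‖ ≤ ‖(a : 𝕜) • x‖ + ‖(b : 𝕜) • y‖ := norm_add_le _ _
        _ = a * ‖x‖ + b * ‖y‖ := by
          rw [norm_smul, norm_smul, RCLike.norm_ofReal, RCLike.norm_ofReal, abs_of_nonneg ha,
            abs_of_nonneg hb]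
        _ ≤ a * 1 + b * 1 := by gcongr
        _ = 1 := by linarith
    · ext i
      simp [RCLike.real_smul_eq_coe_mul]
  have hv : v ∈ closure K := by
    by_contra hv
    obtain ⟨f, u, hfu, huf⟩ := RCLike.geometric_hahn_banach_closed_point (𝕜 := 𝕜) hK.closure
      isClosed_closure hv
    let ψ : StrongDual 𝕜 X := f.comp Φ
    have hψ : ∀ x : X, ‖x‖ ≤ 1 → ‖ψ x‖ ≤ u := by
      intro x hx
      obtain ⟨c, hc, hcx⟩ := exists_norm_eq_one_mul_eq_norm (ψ x)
      have h := hfu (Φ (c • x)) (subset_closure ⟨c • x, by simpa [norm_smul, hc] using hx, rfl⟩)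
      have h2 : f (Φ (c • x)) = (‖ψ x‖ : 𝕜) := by
        rw [← hcx, map_smul, map_smul]; rfl
      rw [h2, RCLike.ofReal_re] at h
      exact h.le
    have hu : 0 ≤ u := (norm_nonneg _).trans (hψ 0 (by simp))
    have hψu : ‖ψ‖ ≤ u := ContinuousLinearMap.opNorm_le_of_unit_norm hu fun x hx => hψ x hx.le
    let e : s → 𝕜 := fun i => f fun j => if i = j then 1 else 0
    have hfv : f v = z ψ := by
      have hf : ∀ w : s → 𝕜, f w = ∑ i, w i * e i := f.toLinearMap.pi_apply_eq_sum_univ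
      have h1 : ψ = ∑ i : s, e i • i.1 := by
        ext x
        change f (Φ x) = _
        simp [hf, Φ, mul_comm]
      simp [h1, hf, v, mul_comm]
    have : RCLike.re (f v) ≤ u := by
      rw [hfv]
      exact (RCLike.re_le_norm _).trans ((z.le_opNorm ψ).trans
        ((mul_le_of_le_one_left (norm_nonneg _) hz).trans hψu))
    linarith
  obtain ⟨_, ⟨x, hx, rfl⟩, hd⟩ := Metric.mem_closure_iff.1 hv ε hε
  refine ⟨x, mem_closedBall_zero_iff.1 hx, fun φ hφ => ?_⟩
  have := (dist_pi_lt_iff hε).1 hd ⟨φ, hφ⟩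
  rwa [dist_comm, dist_eq_norm] at this

/-- A bound for a symmetric bilinear form on the diagonal of the unit ball passes to its extension
to the bidual. Given `z`, Goldstine's theorem yields a sequence `x i` in the unit ball such that
`T (x i) (x j)` is nearly `extendForm T z z` whenever `i ≠ j`; in the value of `T` at the average of
`x 0, …, x (n - 1)` the `n` diagonal terms become negligible. -/
theorem norm_extendForm_self_le (T : X →L[𝕜] X →L[𝕜] 𝕜) (hT : ∀ x y, T x y = T y x) {N : ℝ}
    (hN0 : 0 ≤ N) (hN : ∀ x : X, ‖T x x‖ ≤ N * ‖x‖ ^ 2)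
    (z : StrongDual 𝕜 (StrongDual 𝕜 X)) (hz : ‖z‖ ≤ 1) : ‖extendForm T z z‖ ≤ N := by
  classical
  set t := extendForm T z z
  have key : ∀ ε : ℝ, 0 < ε → ∀ n : ℕ, 0 < n → ‖t‖ ≤ N + 2 * ε + (‖T‖ + ‖t‖) / n := by
    intro ε hε n hn
    obtain ⟨x, hx, hxx⟩ := exists_seq_of_forall_finset_exists
      (fun x : X => ‖x‖ ≤ 1 ∧ ‖contract T z x - t‖ < ε)
      (fun x y : X => ‖T x y - contract T z x‖ < ε) (fun s _ => by
        obtain ⟨y, hy, hys⟩ := exists_norm_le_one_forall_norm_sub_lt z hz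
          (insert (contract T z) (s.image T)) hε
        exact ⟨y, ⟨hy, hys _ (Finset.mem_insert_self _ _)⟩, fun x hx =>
          hys _ (Finset.mem_insert_of_mem (Finset.mem_image_of_mem _ hx))⟩)
    have hlt : ∀ i j, i < j → ‖T (x i) (x j) - t‖ ≤ 2 * ε := fun i j hij => by
      have := norm_add_le (T (x i) (x j) - contract T z (x i)) (contract T z (x i) - t)
      rw [sub_add_sub_cancel] at this
      linarith [hxx i j hij, (hx i).2]
    have hij : ∀ i j, ‖T (x i) (x j) - t‖ ≤ 2 * ε + if i = j then ‖T‖ + ‖t‖ else 0 := by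
      intro i j
      rcases lt_trichotomy i j with h | rfl | h
      · simpa [h.ne] using hlt i j h
      · have h1 : ‖T (x i) (x i)‖ ≤ ‖T‖ := by
          refine (T.le_opNorm₂ _ _).trans ?_
          have h0 := (hx i).1
          calc ‖T‖ * ‖x i‖ * ‖x i‖ ≤ ‖T‖ * 1 * 1 := by gcongr
            _ = ‖T‖ := by ring
        have := norm_sub_le (T (x i) (x i)) t
        simp only [if_true]
        linarith
      · rw [hT]
        simpa [h.ne'] using hlt j i h
    let u : X := ∑ i ∈ Finset.range n, x i
    have hu : ‖u‖ ≤ n := by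
      refine (norm_sum_le_of_le _ fun i _ => (hx i).1).trans ?_
      simp
    have hTu : T u u - (n : 𝕜) ^ 2 * t
        = ∑ i ∈ Finset.range n, ∑ j ∈ Finset.range n, (T (x i) (x j) - t) := by
      simp [u, Finset.sum_sub_distrib, pow_two, mul_assoc]
      exact Finset.sum_comm
    have h1 : ‖T u u - (n : 𝕜) ^ 2 * t‖ ≤ n ^ 2 * (2 * ε) + n * (‖T‖ + ‖t‖) := by
      rw [hTu]
      refine (norm_sum_le_of_le _ fun i _ => norm_sum_le_of_le _ fun j _ => hij i j).trans ?_
      simp only [Finset.sum_add_distrib, Finset.sum_const, Finset.card_range, nsmul_eq_mul,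
        Finset.sum_ite_eq, Finset.mem_range]
      rw [Finset.sum_ite_of_true (by simp)]
      simp
      apply le_of_eq; ring
    have h2 : ‖T u u‖ ≤ N * n ^ 2 :=
      (hN u).trans (by gcongr)
    have h3 : ‖(n : 𝕜) ^ 2 * t‖ = n ^ 2 * ‖t‖ := by simp
    have h4 := norm_sub_norm_le ((n : 𝕜) ^ 2 * t) (T u u)
    rw [norm_sub_rev, h3] at h4
    have hn' : (0 : ℝ) < n := by exact_mod_cast hn
    have h5 : (n : ℝ) ^ 2 * ‖t‖ ≤ n ^ 2 * (N + 2 * ε + (‖T‖ + ‖t‖) / n) := by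
      have : (n : ℝ) ^ 2 * ((‖T‖ + ‖t‖) / n) = n * (‖T‖ + ‖t‖) := by field_simp
      linarith
    exact le_of_mul_le_mul_left h5 (by positivity)
  have key2 : ∀ ε : ℝ, 0 < ε → ‖t‖ ≤ N + 2 * ε := fun ε hε => by
    have h1 : Tendsto (fun n : ℕ => N + 2 * ε + (‖T‖ + ‖t‖) / n) atTop (𝓝 (N + 2 * ε + 0)) :=
      tendsto_const_nhds.add (tendsto_const_div_atTop_nhds_zero_nat _)
    rw [add_zero] at h1
    exact ge_of_tendsto h1 (eventually_atTop.2 ⟨1, fun n hn => key ε hε n hn⟩)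
  refine le_of_forall_pos_le_add fun ε hε => ?_
  linarith [key2 (ε / 2) (by positivity)]

theorem norm_apply_le_norm (P : HomPoly2 𝕜 X Y) {x : X} (hx : ‖x‖ ≤ 1) : ‖P.1 x‖ ≤ ‖P‖ :=
  norm_apply_le_supNorm P hx

theorem norm_apply_le_norm_mul_sq (P : HomPoly2 𝕜 X Y) (x : X) : ‖P.1 x‖ ≤ ‖P‖ * ‖x‖ ^ 2 :=
  norm_apply_le P x

theorem norm_le_of_forall (P : HomPoly2 𝕜 X Y) {C : ℝ} (h : ∀ x : X, ‖x‖ ≤ 1 → ‖P.1 x‖ ≤ C) :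
    ‖P‖ ≤ C :=
  supNorm_le P h

theorem symBilin_self (P : HomPoly2 𝕜 X Y) (x : X) : symBilin P x x = P.1 x := by
  rw [← ofBilin_apply, ofBilin_symBilin]

theorem norm_dual_apply_le {w : StrongDual 𝕜 Y} (hw : ‖w‖ ≤ 1) (y : Y) : ‖w y‖ ≤ ‖y‖ :=
  (w.le_opNorm y).trans (mul_le_of_le_one_left (norm_nonneg _) hw)

/-- Only this inequality is needed; it is in fact an equality. -/
theorem norm_aronBerner_le (P : HomPoly2 𝕜 X Y) : ‖aronBerner P‖ ≤ ‖P‖ := by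
  refine norm_le_of_forall _ fun z hz => ?_
  refine ContinuousLinearMap.opNorm_le_of_unit_norm (norm_nonneg _) fun w hw => ?_
  rw [aronBerner_apply]
  refine norm_extendForm_self_le _ (fun x y => ?_) (norm_nonneg P) (fun x => ?_) z hz
  · rw [compForm_apply, compForm_apply, symBilin_comm]
  · rw [compForm_apply, symBilin_self]
    exact (norm_dual_apply_le hw.le _).trans (norm_apply_le_norm_mul_sq P x)

/-! ### The symmetric bilinear map of a polynomial -/

theorem symBilin_sub (P Q : HomPoly2 𝕜 X Y) : symBilin (P - Q) = symBilin P - symBilin Q := by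
  ext x y
  change (2 : 𝕜)⁻¹ • ((P.1 (x + y) - Q.1 (x + y)) - (P.1 x - Q.1 x) - (P.1 y - Q.1 y))
    = (2 : 𝕜)⁻¹ • (P.1 (x + y) - P.1 x - P.1 y) - (2 : 𝕜)⁻¹ • (Q.1 (x + y) - Q.1 x - Q.1 y)
  module

theorem norm_symBilin_apply_le (P : HomPoly2 𝕜 X Y) {x y : X} (hx : ‖x‖ ≤ 1) (hy : ‖y‖ ≤ 1) :
    ‖symBilin P x y‖ ≤ 3 * ‖P‖ := by
  have h1 : ‖P.1 (x + y)‖ ≤ ‖P‖ * 2 ^ 2 := (norm_apply_le_norm_mul_sq P _).trans (by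
    gcongr
    linarith [norm_add_le x y])
  have h2 := norm_apply_le_norm P hx
  have h3 := norm_apply_le_norm P hy
  have h4 := norm_sub_le (P.1 (x + y) - P.1 x) (P.1 y)
  have h5 := norm_sub_le (P.1 (x + y)) (P.1 x)
  rw [symBilin_apply, norm_smul, norm_inv, RCLike.norm_ofNat]
  linarith

theorem norm_symBilin_le (P : HomPoly2 𝕜 X Y) : ‖symBilin P‖ ≤ 3 * ‖P‖ := by
  have h0 : 0 ≤ 3 * ‖P‖ := by positivity
  refine ContinuousLinearMap.opNorm_le_of_unit_norm h0 fun x hx => ?_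
  exact ContinuousLinearMap.opNorm_le_of_unit_norm h0 fun y hy =>
    norm_symBilin_apply_le P hx.le hy.le

theorem norm_ofBilin_le (B : X →L[𝕜] X →L[𝕜] Y) : ‖ofBilin B‖ ≤ ‖B‖ :=
  norm_le_of_forall _ fun x hx => by
    rw [ofBilin_apply]
    calc ‖B x x‖ ≤ ‖B‖ * ‖x‖ * ‖x‖ := B.le_opNorm₂ x x
      _ ≤ ‖B‖ * 1 * 1 := by gcongr
      _ = ‖B‖ := by ring

theorem ofBilin_sub (B C : X →L[𝕜] X →L[𝕜] Y) : ofBilin (B - C) = ofBilin B - ofBilin C := by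
  ext x
  rfl

/-- Completeness is inherited from the space of bounded bilinear maps, since `P ↦ symBilin P` is
bounded with bounded left inverse `ofBilin`. -/
instance [CompleteSpace Y] : CompleteSpace (HomPoly2 𝕜 X Y) := by
  refine Metric.complete_of_cauchySeq_tendsto fun P hP => ?_
  have hS : CauchySeq fun n => symBilin (P n) := by
    rw [Metric.cauchySeq_iff'] at hP ⊢
    intro ε hε
    obtain ⟨n, hn⟩ := hP (ε / 4) (by positivity)
    refine ⟨n, fun m hm => ?_⟩
    have h := hn m hm
    rw [dist_eq_norm] at h ⊢
    rw [← symBilin_sub]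
    linarith [norm_symBilin_le (P m - P n)]
  obtain ⟨B, hB⟩ := cauchySeq_tendsto_of_complete hS
  refine ⟨ofBilin B, ?_⟩
  rw [tendsto_iff_norm_sub_tendsto_zero] at hB ⊢
  refine squeeze_zero (fun _ => norm_nonneg _) (fun n => ?_) hB
  rw [← ofBilin_symBilin (P n), ← ofBilin_sub, ofBilin_symBilin]
  exact norm_ofBilin_le _

/-- If `f ∘ P` is nearly `‖P‖` at `x`, then `f ∘ S (x, ·)` exceeds `‖P‖` only slightly on the unit
ball, although a general polarization inequality would allow the value `2 ‖P‖`. This comes from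
expanding `f (P (x + t c w))` for small `t`, where `c` is the unimodular scalar for which the terms
of order `0` and `1` in `t` have the same phase. -/
theorem norm_dual_symBilin_le (P : HomPoly2 𝕜 X Y) {f : StrongDual 𝕜 Y} (hf : ‖f‖ ≤ 1) {x w : X}
    (hx : ‖x‖ ≤ 1) (hw : ‖w‖ ≤ 1) {δ t : ℝ} (ht : 0 < t) (h : ‖P‖ - δ ≤ ‖f (P.1 x)‖) :
    ‖f (symBilin P x w)‖ ≤ ‖P‖ + t * ‖P‖ + δ / (2 * t) := by
  obtain ⟨c, hc, hcb⟩ := exists_norm_add_mul_eq (f (P.1 x)) ((2 * t : 𝕜) * f (symBilin P x w))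
  have hct : ‖c * (t : 𝕜)‖ = t := by rw [norm_mul, hc, RCLike.norm_ofReal, abs_of_pos ht, one_mul]
  have hexp : P.1 (x + (c * (t : 𝕜)) • w)
      = P.1 x + (c * (2 * t : 𝕜)) • symBilin P x w + (c * (t : 𝕜)) ^ 2 • P.1 w := by
    rw [← symBilin_self P (x + _)]
    simp only [map_add, map_smul, add_apply, smul_apply, symBilin_self, symBilin_comm P w x]
    module
  have h1 : f (P.1 x) + c * ((2 * t : 𝕜) * f (symBilin P x w))
      = f (P.1 (x + (c * (t : 𝕜)) • w)) - (c * (t : 𝕜)) ^ 2 * f (P.1 w) := by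
    rw [hexp, map_add, map_add, map_smul, map_smul, smul_eq_mul, smul_eq_mul]
    ring
  have h2 : ‖f (P.1 (x + (c * (t : 𝕜)) • w))‖ ≤ ‖P‖ * (1 + t) ^ 2 := by
    refine (norm_dual_apply_le hf _).trans ((norm_apply_le_norm_mul_sq P _).trans ?_)
    gcongr
    refine (norm_add_le _ _).trans (add_le_add hx ?_)
    rw [norm_smul, hct]
    exact mul_le_of_le_one_right ht.le hw
  have h3 : ‖(c * (t : 𝕜)) ^ 2 * f (P.1 w)‖ ≤ t ^ 2 * ‖P‖ := by
    rw [norm_mul, norm_pow, hct]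
    gcongr
    exact (norm_dual_apply_le hf _).trans (norm_apply_le_norm P hw)
  have h4 : ‖(2 * t : 𝕜) * f (symBilin P x w)‖ = 2 * t * ‖f (symBilin P x w)‖ := by
    rw [norm_mul, norm_mul, RCLike.norm_ofReal, abs_of_pos ht, RCLike.norm_ofNat]
  have h5 := norm_sub_le (f (P.1 (x + (c * (t : 𝕜)) • w))) ((c * (t : 𝕜)) ^ 2 * f (P.1 w))
  rw [← h1, hcb, h4] at h5
  have h6 : 2 * t * (‖P‖ + t * ‖P‖ + δ / (2 * t)) = 2 * t * ‖P‖ + 2 * t ^ 2 * ‖P‖ + δ := by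
    field_simp
  refine le_of_mul_le_mul_left (?_ : 2 * t * _ ≤ 2 * t * _) (by positivity)
  rw [h6]
  nlinarith

/-! ### Perturbations of a polynomial -/

/-- The polynomial `x ↦ T (x, x) y` with values in the line spanned by `y`. -/
noncomputable def formSmul (T : X →L[𝕜] X →L[𝕜] 𝕜) (y : Y) : HomPoly2 𝕜 X Y :=
  ofBilin ((ContinuousLinearMap.compL 𝕜 X 𝕜 Y (ContinuousLinearMap.toSpanSingleton 𝕜 y)).comp T)

theorem add_formSmul_apply (P : HomPoly2 𝕜 X Y) (T : X →L[𝕜] X →L[𝕜] 𝕜) (y : Y) (x : X) :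
    (P + formSmul T y).1 x = P.1 x + T x x • y := rfl

theorem norm_apply_sub_le (P Q : HomPoly2 𝕜 X Y) {x : X} (hx : ‖x‖ ≤ 1) :
    ‖P.1 x - Q.1 x‖ ≤ ‖P - Q‖ :=
  norm_apply_le_norm (P - Q) hx

theorem norm_symBilin_sub_le (P Q : HomPoly2 𝕜 X Y) {x y : X} (hx : ‖x‖ ≤ 1) (hy : ‖y‖ ≤ 1) :
    ‖symBilin P x y - symBilin Q x y‖ ≤ 3 * ‖P - Q‖ := by
  have h := norm_symBilin_apply_le (P - Q) hx hy
  rwa [symBilin_sub] at h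

/-- Lindenstrauss' perturbation. Let `T x` be bilinear forms, uniformly bounded on the diagonal,
with `T x (x, x) ≥ 0`. For `x` nearly maximizing `‖P‖` and a small `ε`, adding
`ε T x (·, ·) P x` to `P` yields a polynomial all of whose near-maximizers `y`, even after a further
much smaller perturbation, satisfy `|T x (y, y)| ≥ T x (x, x) - σ`: at `x` the norm has grown by
the factor `1 + ε T x (x, x)`, and a near-maximizer must do no worse. -/
theorem exists_perturbation {P : HomPoly2 𝕜 X Y} (hP : P ≠ 0) (T : X → X →L[𝕜] X →L[𝕜] 𝕜) {A : ℝ}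
    (hA : ∀ x, ‖x‖ ≤ 1 → ∀ y, ‖y‖ ≤ 1 → ‖T x y y‖ ≤ A)
    (hT : ∀ x, T x x x = (‖T x x x‖ : 𝕜)) {ρ σ : ℝ} (hρ : 0 < ρ) (hσ : 0 < σ) :
    ∃ x : X, ‖x‖ ≤ 1 ∧ ∃ (P' : HomPoly2 𝕜 X Y) (r η : ℝ), 0 < r ∧ 0 < η ∧
      closedBall P' r ⊆ closedBall P ρ ∧ ∀ R ∈ closedBall P' r, ‖R‖ - ρ ≤ ‖R.1 x‖ ∧
        ∀ y, ‖y‖ ≤ 1 → ‖R‖ - η ≤ ‖R.1 y‖ → ‖T x x x‖ - σ ≤ ‖T x y y‖ := by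
  have hA0 : 0 ≤ A := (norm_nonneg _).trans (hA 0 (by simp) 0 (by simp))
  set N := ‖P‖
  have hN : 0 < N := norm_pos_iff.2 hP
  obtain ⟨ε, hε, hεA⟩ : ∃ ε : ℝ, 0 < ε ∧ ε * A * N ≤ ρ / 4 := by
    refine ⟨ρ / (4 * N * (A + 1)), by positivity, ?_⟩
    rw [div_mul_eq_mul_div, div_mul_eq_mul_div, div_le_div_iff₀ (by positivity) (by positivity)]
    have : 0 ≤ ρ * N := by positivity
    nlinarith
  -- `κ` bounds the four errors in the estimate at a near-maximizer `y` (from the choice of `x`, from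
  -- that of `y`, and twice from `R - P'`), against a gain of `ε N` times the deficit of `‖T x y y‖`
  obtain ⟨κ, hκ, hκσ, hκρ⟩ : ∃ κ : ℝ, 0 < κ ∧ 4 * κ ≤ ε * N * σ ∧ 8 * κ ≤ ρ := by
    refine ⟨min (ε * N * σ / 4) (ρ / 8), by positivity, ?_, ?_⟩
    · linarith [min_le_left (ε * N * σ / 4) (ρ / 8)]
    · linarith [min_le_right (ε * N * σ / 4) (ρ / 8)]
  obtain ⟨η₀, hη₀, hη₀κ⟩ : ∃ η₀ : ℝ, 0 < η₀ ∧ η₀ * (1 + ε * A) = κ :=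
    ⟨κ / (1 + ε * A), by positivity, by field_simp⟩
  obtain ⟨x, hx, hxN⟩ : ∃ x : X, ‖x‖ ≤ 1 ∧ N - η₀ ≤ ‖P.1 x‖ := by
    by_contra! hcon
    linarith [norm_le_of_forall P fun x hx => (hcon x hx).le]
  have hxN' : ‖P.1 x‖ ≤ N := norm_apply_le_norm P hx
  set a := ‖T x x x‖
  have ha0 : 0 ≤ a := norm_nonneg _
  have haA : a ≤ A := hA x hx x hx
  let P' : HomPoly2 𝕜 X Y := P + formSmul (T x) ((ε : 𝕜) • P.1 x)
  have hP'x : ‖P'.1 x‖ = (1 + ε * a) * ‖P.1 x‖ := by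
    have h : P'.1 x = ((1 + ε * a : ℝ) : 𝕜) • P.1 x := by
      rw [add_formSmul_apply, hT x]
      push_cast
      module
    rw [h, norm_smul, RCLike.norm_ofReal, abs_of_nonneg (by positivity)]
  have hadd : ∀ y, ‖T x y y • ((ε : 𝕜) • P.1 x)‖ ≤ ε * ‖T x y y‖ * N := fun y => by
    rw [norm_smul, norm_smul, RCLike.norm_ofReal, abs_of_pos hε]
    calc ‖T x y y‖ * (ε * ‖P.1 x‖) ≤ ‖T x y y‖ * (ε * N) := by gcongr
      _ = _ := by ring
  have hP'P : ‖P' - P‖ ≤ ε * A * N := by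
    refine norm_le_of_forall _ fun y hy => ?_
    have h : (P' - P).1 y = T x y y • ((ε : 𝕜) • P.1 x) := by
      change P.1 y + T x y y • ((ε : 𝕜) • P.1 x) - P.1 y = _
      abel
    rw [h]
    refine (hadd y).trans ?_
    gcongr
    exact hA x hx y hy
  have hη₀le : η₀ * (1 + ε * a) ≤ κ := by
    rw [← hη₀κ]
    gcongr
  have hlow : N + ε * a * N - κ ≤ ‖P'.1 x‖ := by
    rw [hP'x]
    have : (1 + ε * a) * (N - η₀) ≤ (1 + ε * a) * ‖P.1 x‖ := by gcongr
    linarith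
  refine ⟨x, hx, P', κ, κ, hκ, hκ, ?_, fun R hR => ?_⟩
  · refine closedBall_subset_closedBall' ?_
    rw [dist_eq_norm]
    linarith
  rw [mem_closedBall, dist_eq_norm] at hR
  have hRx : ∀ y, ‖y‖ ≤ 1 → |‖R.1 y‖ - ‖P'.1 y‖| ≤ κ := fun y hy =>
    (abs_norm_sub_norm_le _ _).trans ((norm_apply_sub_le R P' hy).trans hR)
  have hεa : 0 ≤ ε * a * N := by positivity
  have h1 := abs_le.1 (hRx x hx)
  refine ⟨?_, fun y hy hRy => ?_⟩
  · have h2 : ‖R‖ ≤ ‖P‖ + ‖P' - P‖ + ‖R - P'‖ := by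
      have h3 := norm_add_le (P + (P' - P)) (R - P')
      have h4 := norm_add_le P (P' - P)
      rw [add_sub_cancel, add_sub_cancel] at h3
      rw [add_sub_cancel] at h4
      linarith
    linarith
  · have h2 := abs_le.1 (hRx y hy)
    have h3 := norm_apply_le_norm R hx
    have h4 : ‖P'.1 y‖ ≤ N + ε * ‖T x y y‖ * N := by
      rw [add_formSmul_apply]
      exact (norm_add_le _ _).trans (add_le_add (norm_apply_le_norm P hy) (hadd y))
    have h5 : (ε * N) * (a - ‖T x y y‖) ≤ (ε * N) * σ := by linarith
    linarith [le_of_mul_le_mul_left h5 (by positivity)]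

/-- After a small perturbation of `P`, robust under further perturbation, a single functional `f`
nearly norms the values at all near-maximizers. -/
theorem exists_perturbation_functional {P : HomPoly2 𝕜 X Y} (hP : P ≠ 0) {ρ : ℝ} (hρ : 0 < ρ) :
    ∃ f : StrongDual 𝕜 Y, ‖f‖ ≤ 1 ∧ ∃ (P' : HomPoly2 𝕜 X Y) (r η : ℝ), 0 < r ∧ 0 < η ∧
      closedBall P' r ⊆ closedBall P ρ ∧ ∀ R ∈ closedBall P' r,
        ∀ y, ‖y‖ ≤ 1 → ‖R‖ - η ≤ ‖R.1 y‖ → ‖R‖ - ρ ≤ ‖f (R.1 y)‖ := by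
  choose f hf hfx using fun x : X => exists_dual_vector'' 𝕜 (P.1 x)
  have hfa : ∀ x y, compForm (f x) (symBilin P) y y = f x (P.1 y) := fun x y => by
    rw [compForm_apply, symBilin_self]
  have hfn : ∀ x, ‖f x (P.1 x)‖ = ‖P.1 x‖ := fun x => by
    rw [hfx, RCLike.norm_ofReal, abs_norm]
  obtain ⟨x, hx, P', r, η, hr, hη, hsub, H⟩ := exists_perturbation hP
    (fun x => compForm (f x) (symBilin P)) (A := ‖P‖) (fun x _ y hy => by
      rw [hfa]
      exact (norm_dual_apply_le (hf x) _).trans (norm_apply_le_norm P hy)) (fun x => by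
      rw [hfa, hfn, hfx]) (ρ := ρ / 4) (σ := ρ / 4) (by positivity) (by positivity)
  refine ⟨f x, hf x, P', r, η, hr, hη,
    hsub.trans (closedBall_subset_closedBall (by linarith)), fun R hR y hy hRy => ?_⟩
  obtain ⟨h1, h2⟩ := H R hR
  have h3 := h2 y hy hRy
  rw [hfa, hfa, hfn] at h3
  have hRP := hsub hR
  rw [mem_closedBall, dist_eq_norm] at hRP
  have h4 : ‖f x (R.1 y) - f x (P.1 y)‖ ≤ ρ / 4 := by
    rw [← map_sub]
    exact (norm_dual_apply_le (hf x) _).trans ((norm_apply_sub_le R P hy).trans hRP)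
  have h5 := (norm_apply_sub_le R P hx).trans hRP
  have h6 := norm_sub_norm_le (R.1 x) (P.1 x)
  have h7 := norm_sub_norm_le (f x (P.1 y)) (f x (R.1 y))
  rw [norm_sub_rev] at h7
  linarith

/-- Given finitely many functionals `f i`, after a small perturbation of `P`, robust under further
perturbation, some near-maximizer `x` is such that the numbers `|f i (S (x, y))|`, for any
near-maximizer `y`, are on the whole no smaller than the numbers `|f i (P x)|`. -/
theorem exists_perturbation_point {ι : Type*} (s : Finset ι) {f : ι → StrongDual 𝕜 Y}
    (hf : ∀ i, ‖f i‖ ≤ 1) {P : HomPoly2 𝕜 X Y} (hP : P ≠ 0) {ρ : ℝ} (hρ : 0 < ρ) :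
    ∃ x : X, ‖x‖ ≤ 1 ∧ ∃ (P' : HomPoly2 𝕜 X Y) (r η : ℝ), 0 < r ∧ 0 < η ∧
      closedBall P' r ⊆ closedBall P ρ ∧ ∀ R ∈ closedBall P' r, ‖R‖ - ρ ≤ ‖R.1 x‖ ∧
        ∀ y, ‖y‖ ≤ 1 → ‖R‖ - η ≤ ‖R.1 y‖ →
          ∑ i ∈ s, ‖f i (R.1 x)‖ - 1 ≤ ∑ i ∈ s, ‖f i (symBilin R x y)‖ := by
  choose θ hθ hθf using fun (x : X) (i : ι) => exists_norm_eq_one_mul_eq_norm (f i (P.1 x))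
  -- the square of `h x` is the form used for the perturbation
  let h : X → StrongDual 𝕜 X := fun x => (∑ i ∈ s, θ x i • f i).comp (symBilin P x)
  have happ : ∀ x y, h x y = ∑ i ∈ s, θ x i * f i (symBilin P x y) := fun x y => by simp [h]
  have hle : ∀ x y, ‖h x y‖ ≤ ∑ i ∈ s, ‖f i (symBilin P x y)‖ := fun x y => by
    rw [happ]
    exact norm_sum_le_of_le _ fun i _ => by rw [norm_mul, hθ, one_mul]
  have hself : ∀ x, h x x = ((∑ i ∈ s, ‖f i (P.1 x)‖ : ℝ) : 𝕜) := fun x => by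
    rw [happ]
    push_cast
    exact Finset.sum_congr rfl fun i _ => by rw [symBilin_self, hθf]
  have hselfn : ∀ x, ‖h x x‖ = ∑ i ∈ s, ‖f i (P.1 x)‖ := fun x => by
    rw [hself, RCLike.norm_ofReal, abs_of_nonneg (by positivity)]
  have hbd : ∀ x, ‖x‖ ≤ 1 → ∀ y, ‖y‖ ≤ 1 → ‖h x y‖ ≤ s.card * (3 * ‖P‖) := fun x hx y hy => by
    refine (hle x y).trans ((Finset.sum_le_card_nsmul _ _ _ fun i _ => ?_).trans
      (nsmul_eq_mul _ _).le)
    exact (norm_dual_apply_le (hf i) _).trans (norm_symBilin_apply_le P hx hy)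
  have hTa : ∀ x y, (h x).smulRight (h x) y y = h x y * h x y := fun x y => rfl
  obtain ⟨ρ', hρ', hρ'ρ, hρ's⟩ : ∃ ρ' : ℝ, 0 < ρ' ∧ ρ' ≤ ρ ∧ s.card * ρ' ≤ 1 / 8 := by
    refine ⟨min ρ (1 / (8 * (s.card + 1))), by positivity, min_le_left _ _, ?_⟩
    calc (s.card : ℝ) * min ρ (1 / (8 * (s.card + 1)))
        ≤ (s.card + 1) * (1 / (8 * (s.card + 1))) := by
          gcongr
          · linarith
          · exact min_le_right _ _
      _ = 1 / 8 := by field_simp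
  obtain ⟨x, hx, P', r, η, hr, hη, hsub, H⟩ := exists_perturbation hP
    (fun x => (h x).smulRight (h x)) (A := (s.card * (3 * ‖P‖)) * (s.card * (3 * ‖P‖)))
    (fun x hx y hy => by
      rw [hTa, norm_mul]
      exact mul_le_mul (hbd x hx y hy) (hbd x hx y hy) (norm_nonneg _) (by positivity))
    (fun x => by
      rw [hTa, norm_mul, hselfn, hself]
      push_cast
      rfl) hρ' (σ := 1 / 4) (by norm_num)
  refine ⟨x, hx, P', r, η, hr, hη,
    hsub.trans (closedBall_subset_closedBall hρ'ρ), fun R hR => ?_⟩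
  obtain ⟨h1, h2⟩ := H R hR
  refine ⟨by linarith, fun y hy hRy => ?_⟩
  have h3 := h2 y hy hRy
  rw [hTa, hTa, norm_mul, norm_mul] at h3
  have hRP := hsub hR
  rw [mem_closedBall, dist_eq_norm] at hRP
  have h4 : ‖h x x‖ - 1 / 2 ≤ ‖h x y‖ := by
    by_contra! hcon
    nlinarith [norm_nonneg (h x y)]
  have h5 : ∑ i ∈ s, ‖f i (R.1 x)‖ ≤ ∑ i ∈ s, ‖f i (P.1 x)‖ + s.card * ρ' := by
    rw [← nsmul_eq_mul, ← Finset.sum_const, ← Finset.sum_add_distrib]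
    refine Finset.sum_le_sum fun i _ => ?_
    have h6 : ‖f i (R.1 x - P.1 x)‖ ≤ ρ' :=
      (norm_dual_apply_le (hf i) _).trans ((norm_apply_sub_le R P hx).trans hRP)
    rw [map_sub] at h6
    linarith [norm_sub_norm_le (f i (R.1 x)) (f i (P.1 x))]
  have h7 : ∑ i ∈ s, ‖f i (symBilin P x y)‖
      ≤ ∑ i ∈ s, ‖f i (symBilin R x y)‖ + s.card * (3 * ρ') := by
    rw [← nsmul_eq_mul, ← Finset.sum_const, ← Finset.sum_add_distrib]
    refine Finset.sum_le_sum fun i _ => ?_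
    have h6 : ‖f i (symBilin R x y - symBilin P x y)‖ ≤ 3 * ρ' :=
      (norm_dual_apply_le (hf i) _).trans ((norm_symBilin_sub_le R P hx hy).trans (by linarith))
    rw [map_sub, norm_sub_rev] at h6
    linarith [norm_sub_norm_le (f i (symBilin P x y)) (f i (symBilin R x y))]
  have h8 := hle x y
  rw [hselfn] at h4
  linarith

/-! ### Iterated perturbation -/

variable (𝕜 X Y) in
/-- A stage of the iteration: a polynomial, the radius of the ball around it in which all later
polynomials lie, a tolerance `τ` such that all later points are `τ`-near-maximizers, the
functionals chosen so far (stage `n` fixes `f m` for `m < n`), and the point chosen last. -/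
structure Stage where
  /-- the polynomial -/
  P : HomPoly2 𝕜 X Y
  /-- the radius of the ball around `P` -/
  r : ℝ
  /-- the tolerance for near-maximizers -/
  τ : ℝ
  /-- the functionals -/
  f : ℕ → StrongDual 𝕜 Y
  /-- the last point -/
  x : X

/-- The requirements on a single stage. -/
structure Stage.Good (s : Stage 𝕜 X Y) : Prop where
  r_pos : 0 < s.r
  τ_pos : 0 < s.τ
  norm_f : ∀ m, ‖s.f m‖ ≤ 1
  zero_notMem : (0 : HomPoly2 𝕜 X Y) ∉ closedBall s.P s.r

/-- `s'` is an admissible successor of the `n`-th stage `s`: it fixes the functional `f n` and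
provides a point `x`, with estimates valid for every polynomial `R` in the ball of `s'`. -/
structure Stage.Step (δ : ℕ → ℝ) (n : ℕ) (s s' : Stage 𝕜 X Y) : Prop where
  subset : closedBall s'.P s'.r ⊆ closedBall s.P s.r
  r_le : s'.r ≤ (1 / 2) ^ n
  τ_le : s'.τ ≤ s.τ
  f_eq : ∀ m < n, s'.f m = s.f m
  norm_x : ‖s'.x‖ ≤ 1
  norm_sub_le_apply : ∀ R ∈ closedBall s'.P s'.r, ‖R‖ - s.τ ≤ ‖R.1 s'.x‖
  norm_sub_le_dual : ∀ R ∈ closedBall s'.P s'.r, ‖R‖ - δ n ≤ ‖s'.f n (R.1 s'.x)‖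
  norm_sub_le_dual_of_near : ∀ R ∈ closedBall s'.P s'.r, ∀ y, ‖y‖ ≤ 1 → ‖R‖ - s'.τ ≤ ‖R.1 y‖ →
    ‖R‖ - δ n ≤ ‖s'.f n (R.1 y)‖
  sum_le_of_near : ∀ R ∈ closedBall s'.P s'.r, ∀ y, ‖y‖ ≤ 1 → ‖R‖ - s'.τ ≤ ‖R.1 y‖ →
    ∑ m ∈ Finset.range (n + 1), ‖s'.f m (R.1 s'.x)‖ - 1
      ≤ ∑ m ∈ Finset.range (n + 1), ‖s'.f m (symBilin R s'.x y)‖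

theorem Stage.Good.exists_step {s : Stage 𝕜 X Y} (hs : s.Good) {δ : ℕ → ℝ} (hδ : ∀ n, 0 < δ n)
    (n : ℕ) : ∃ s' : Stage 𝕜 X Y, s'.Good ∧ Stage.Step δ n s s' := by
  have hP : s.P ≠ 0 := fun h => hs.zero_notMem (h ▸ mem_closedBall_self hs.r_pos.le)
  obtain ⟨f, hf, P₁, r₁, η₁, hr₁, hη₁, hsub₁, H₁⟩ :=
    exists_perturbation_functional hP (lt_min hs.r_pos (hδ n))
  have hsub₁' := hsub₁.trans (closedBall_subset_closedBall (min_le_left s.r (δ n)))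
  have hP₁ : P₁ ≠ 0 := fun h => hs.zero_notMem (hsub₁' (h ▸ mem_closedBall_self hr₁.le))
  have hf' : ∀ m, ‖Function.update s.f n f m‖ ≤ 1 := fun m => by
    rcases eq_or_ne m n with rfl | h
    · simpa using hf
    · simpa [h] using hs.norm_f m
  obtain ⟨x, hx, P₂, r₂, η₂, hr₂, hη₂, hsub₂, H₂⟩ :=
    exists_perturbation_point (Finset.range (n + 1)) hf' hP₁ (ρ := min r₁ (min s.τ η₁))
      (lt_min hr₁ (lt_min hs.τ_pos hη₁))
  have hsub₂' := hsub₂.trans (closedBall_subset_closedBall (min_le_left _ _))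
  have hball : closedBall P₂ (min r₂ ((1 / 2) ^ n)) ⊆ closedBall P₂ r₂ :=
    closedBall_subset_closedBall (min_le_left _ _)
  have hτ : min r₁ (min s.τ η₁) ≤ s.τ := (min_le_right _ _).trans (min_le_left _ _)
  have hη : min r₁ (min s.τ η₁) ≤ η₁ := (min_le_right _ _).trans (min_le_right _ _)
  have hη₁' : min s.τ (min η₁ η₂) ≤ η₁ := (min_le_right _ _).trans (min_le_left _ _)
  have hη₂' : min s.τ (min η₁ η₂) ≤ η₂ := (min_le_right _ _).trans (min_le_right _ _)
  have hnear : ∀ R ∈ closedBall P₂ (min r₂ ((1 / 2) ^ n)), ∀ y, ‖y‖ ≤ 1 → ‖R‖ - η₁ ≤ ‖R.1 y‖ →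
      ‖R‖ - δ n ≤ ‖Function.update s.f n f n (R.1 y)‖ := fun R hR y hy hRy => by
    rw [Function.update_self]
    linarith [H₁ R (hsub₂' (hball hR)) y hy hRy, min_le_right s.r (δ n)]
  refine ⟨⟨P₂, min r₂ ((1 / 2) ^ n), min s.τ (min η₁ η₂), Function.update s.f n f, x⟩, ?_, ?_⟩
  · exact ⟨lt_min hr₂ (by positivity), lt_min hs.τ_pos (lt_min hη₁ hη₂), hf',
      fun h => hs.zero_notMem (hsub₁' (hsub₂' (hball h)))⟩
  · refine ⟨(hball.trans hsub₂').trans hsub₁', min_le_right _ _, min_le_left _ _, fun m hm => ?_, hx,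
      fun R hR => ?_, fun R hR => ?_, fun R hR y hy hRy => ?_, fun R hR y hy hRy => ?_⟩
    · exact Function.update_of_ne hm.ne _ _
    · linarith [(H₂ R (hball hR)).1]
    · exact hnear R hR x hx (by linarith [(H₂ R (hball hR)).1])
    · exact hnear R hR y hy (by linarith [hRy])
    · exact (H₂ R (hball hR)).2 y hy (by linarith [hRy])

/-- Arbitrarily close to a nonzero polynomial there is a polynomial `P` with points `x k` of the
unit ball and functionals `f m` such that every `f m` nearly norms `P (x k)` for all `k ≥ m`, and
such that the numbers `|f m (S (x k, x j))|`, `m ≤ k < j`, are on the whole no smaller than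
`|f m (P (x k))|`. -/
theorem exists_nearly_norming_sequences [CompleteSpace Y] {P₀ : HomPoly2 𝕜 X Y} (hP₀ : P₀ ≠ 0)
    {ε : ℝ} (hε : 0 < ε) {δ : ℕ → ℝ} (hδ : ∀ n, 0 < δ n) :
    ∃ (P : HomPoly2 𝕜 X Y) (x : ℕ → X) (f : ℕ → StrongDual 𝕜 Y), dist P P₀ ≤ ε ∧
      (∀ k, ‖x k‖ ≤ 1) ∧ (∀ m, ‖f m‖ ≤ 1) ∧
      (∀ m k, m ≤ k → ‖P‖ - δ m ≤ ‖f m (P.1 (x k))‖) ∧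
      ∀ k j, k < j → ∑ m ∈ Finset.range (k + 1), ‖f m (P.1 (x k))‖ - 1
        ≤ ∑ m ∈ Finset.range (k + 1), ‖f m (symBilin P (x k) (x j))‖ := by
  have hN : 0 < ‖P₀‖ := norm_pos_iff.2 hP₀
  let s₀ : Stage 𝕜 X Y := ⟨P₀, min ε (‖P₀‖ / 2), 1, 0, 0⟩
  have hs₀ : s₀.Good := by
    refine ⟨lt_min hε (by positivity), one_pos, by simp [s₀], ?_⟩
    rw [mem_closedBall, dist_zero_left, not_le]
    exact (min_le_right _ _).trans_lt (by linarith)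
  choose! next hgood hstep using fun (n : ℕ) (s : Stage 𝕜 X Y) (hs : s.Good) =>
    hs.exists_step hδ n
  obtain ⟨s, hs0, hs, H⟩ : ∃ s : ℕ → Stage 𝕜 X Y, s 0 = s₀ ∧ (∀ n, (s n).Good) ∧
      ∀ n, Stage.Step δ n (s n) (s (n + 1)) := by
    let s : ℕ → Stage 𝕜 X Y := fun n => Nat.rec s₀ next n
    have hs : ∀ n, (s n).Good := fun n => by
      induction n with
      | zero => exact hs₀
      | succ n ih => exact hgood n _ ih
    exact ⟨s, rfl, hs, fun n => hstep n _ (hs n)⟩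
  have hanti : Antitone fun n => closedBall (s n).P (s n).r :=
    antitone_nat_of_succ_le fun n => (H n).subset
  have hmem : ∀ n j, n ≤ j → (s j).P ∈ closedBall (s n).P (s n).r := fun n j hnj =>
    hanti hnj (mem_closedBall_self (hs j).r_pos.le)
  have hτ : Antitone fun n => (s n).τ := antitone_nat_of_succ_le fun n => (H n).τ_le
  have hfeq : ∀ m k, m + 1 ≤ k → (s k).f m = (s (m + 1)).f m := fun m k hk => by
    induction k, hk using Nat.le_induction with
    | base => rfl
    | succ k hk ih => rw [(H k).f_eq m hk, ih]
  have hcauchy : CauchySeq fun n => (s (n + 1)).P := by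
    refine cauchySeq_of_le_tendsto_0' (fun n => (1 / 2 : ℝ) ^ n) (fun n j hnj => ?_)
      (tendsto_pow_atTop_nhds_zero_of_lt_one (by norm_num) (by norm_num))
    rw [dist_comm]
    exact (hmem (n + 1) (j + 1) (by omega)).trans (H n).r_le
  obtain ⟨P, hlim⟩ := cauchySeq_tendsto_of_complete hcauchy
  have hP : ∀ n, P ∈ closedBall (s n).P (s n).r := fun n =>
    isClosed_closedBall.mem_of_tendsto hlim
      (eventually_atTop.2 ⟨n, fun j hj => hmem n (j + 1) (by omega)⟩)
  have hnear : ∀ k j, k < j → ‖P‖ - (s (k + 1)).τ ≤ ‖P.1 (s (j + 1)).x‖ := fun k j hkj => by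
    have h : (s j).τ ≤ (s (k + 1)).τ := hτ hkj
    linarith [(H j).norm_sub_le_apply P (hP (j + 1))]
  have hdist : dist P P₀ ≤ ε := by
    have h := hP 0
    rw [hs0] at h
    exact (mem_closedBall.1 h).trans (min_le_left _ _)
  refine ⟨P, fun k => (s (k + 1)).x, fun m => (s (m + 1)).f m, hdist,
    fun k => (H k).norm_x, fun m => (hs (m + 1)).norm_f m, fun m k hmk => ?_, fun k j hkj => ?_⟩
  · rcases hmk.eq_or_lt with rfl | hmk
    · exact (H m).norm_sub_le_dual P (hP _)
    · exact (H m).norm_sub_le_dual_of_near P (hP _) _ (H k).norm_x (hnear m k hmk)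
  · have h := (H k).sum_le_of_near P (hP _) _ (H j).norm_x (hnear k j hkj)
    have hf : ∀ v : ℕ → Y, ∑ m ∈ Finset.range (k + 1), ‖(s (m + 1)).f m (v m)‖
        = ∑ m ∈ Finset.range (k + 1), ‖(s (k + 1)).f m (v m)‖ := fun v =>
      Finset.sum_congr rfl fun m hm => by
        rw [hfeq m (k + 1) (Nat.succ_le_of_lt (Finset.mem_range.1 hm))]
    rwa [hf fun _ => _, hf fun _ => _]

/-! ### Norm attainment at a weak-star limit -/

theorem exists_bidual_tendsto {x : ℕ → X} (hx : ∀ k, ‖x k‖ ≤ 1) (U : Ultrafilter ℕ) :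
    ∃ z : StrongDual 𝕜 (StrongDual 𝕜 X), ‖z‖ ≤ 1 ∧
      ∀ φ : StrongDual 𝕜 X, Tendsto (fun k => φ (x k)) U (𝓝 (z φ)) := by
  let J : ℕ → WeakDual 𝕜 (StrongDual 𝕜 X) := fun k =>
    StrongDual.toWeakDual (inclusionInDoubleDual 𝕜 X (x k))
  have hJ : ∀ k, J k ∈ WeakDual.toStrongDual ⁻¹'
      closedBall (0 : StrongDual 𝕜 (StrongDual 𝕜 X)) 1 := fun k => by
    refine mem_closedBall_zero_iff.2 ?_
    exact (double_dual_bound 𝕜 X (x k)).trans (hx k)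
  obtain ⟨z, hz, hzU⟩ := (WeakDual.isCompact_closedBall (0 : StrongDual 𝕜 (StrongDual 𝕜 X))
    1).ultrafilter_le_nhds (U.map J) (by
      rw [Ultrafilter.coe_map, le_principal_iff]
      exact Filter.mem_map.2 (Filter.univ_mem' hJ))
  refine ⟨WeakDual.toStrongDual z, mem_closedBall_zero_iff.1 hz, fun φ => ?_⟩
  exact ((WeakDual.eval_continuous φ).tendsto z).comp hzU

/-- If `P` admits sequences as in `exists_nearly_norming_sequences`, then its Aron-Berner extension
attains its norm at any weak-star cluster point `z` of the points `x k`. The value of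
`aronBerner P z` at `f m` is the iterated limit of `f m (S (x k, x j))`, first in `j` and then in
`k`. If all of these values were at most `‖P‖ - c`, then for large `k` many summands of
`∑ m ≤ k, |f m (S (x k, z))|` would fall short of `‖P‖` by `c`; the others exceed `‖P‖` by a
summable amount only (`norm_dual_symBilin_le`), and the sum as a whole falls short of
`(k + 1) ‖P‖` by a bounded amount only. -/
theorem attainsNorm_aronBerner_of_sequences {P : HomPoly2 𝕜 X Y} {x : ℕ → X}
    {f : ℕ → StrongDual 𝕜 Y} (hx : ∀ k, ‖x k‖ ≤ 1) (hf : ∀ m, ‖f m‖ ≤ 1)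
    (hfx : ∀ m k, m ≤ k → ‖P‖ - (1 / 4) ^ m ≤ ‖f m (P.1 (x k))‖)
    (hS : ∀ k j, k < j → ∑ m ∈ Finset.range (k + 1), ‖f m (P.1 (x k))‖ - 1
        ≤ ∑ m ∈ Finset.range (k + 1), ‖f m (symBilin P (x k) (x j))‖) :
    AttainsNorm (aronBerner P) := by
  obtain ⟨z, hz, hlim⟩ := exists_bidual_tendsto (𝕜 := 𝕜) hx (hyperfilter ℕ)
  have hU : ((hyperfilter ℕ : Ultrafilter ℕ) : Filter ℕ) ≤ atTop := Nat.hyperfilter_le_atTop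
  refine ⟨z, hz, le_antisymm (norm_apply_le_norm _ hz) ((norm_aronBerner_le P).trans ?_)⟩
  by_contra! hlt
  obtain ⟨N, hNP⟩ : ∃ N, N = ‖P‖ := ⟨_, rfl⟩
  rw [← hNP] at hlt
  simp only [← hNP] at hfx
  have hN : 0 ≤ N := hNP ▸ norm_nonneg P
  obtain ⟨c, hc, hcz⟩ : ∃ c : ℝ, 0 < c ∧ ‖(aronBerner P).1 z‖ < N - c :=
    ⟨(N - ‖(aronBerner P).1 z‖) / 2, by linarith, by linarith⟩
  -- `σ m k` is the norm of the limit of `f m (S (x k, x j))` in `j`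
  let σ : ℕ → ℕ → ℝ := fun m k => ‖z (compForm (f m) (symBilin P) (x k))‖
  have hσlim : ∀ m k, Tendsto (fun j => ‖f m (symBilin P (x k) (x j))‖) (hyperfilter ℕ)
      (𝓝 (σ m k)) := fun m k => (hlim (compForm (f m) (symBilin P) (x k))).norm
  have hσsmall : ∀ m, ∀ᶠ k in (hyperfilter ℕ : Filter ℕ), σ m k < N - c := fun m => by
    refine (hlim (contract (compForm (f m) (symBilin P)) z)).norm.eventually_lt_const ?_
    exact (((aronBerner P).1 z).le_of_opNorm_le le_rfl (f m) |>.trans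
      (mul_le_of_le_one_right (norm_nonneg _) (hf m))).trans_lt hcz
  -- the choice `t = 2⁻ᵐ` balances `t ‖P‖` against `4⁻ᵐ / (2 t)`
  have hσle : ∀ m k, m ≤ k → σ m k ≤ N + (1 / 2) ^ m * (N + 1 / 2) := fun m k hmk => by
    refine le_of_tendsto (hσlim m k) (Eventually.of_forall fun j => ?_)
    refine (norm_dual_symBilin_le P (hf m) (hx k) (hx j) (t := (1 / 2) ^ m) (by positivity)
      (hNP ▸ hfx m k hmk)).trans (le_of_eq ?_)
    have h : (1 / 4 : ℝ) ^ m = (1 / 2) ^ m * (1 / 2) ^ m := by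
      rw [← mul_pow]; norm_num
    rw [h, ← hNP]
    field_simp
    ring
  have hσsum : ∀ k, ∑ m ∈ Finset.range (k + 1), (N - (1 / 4) ^ m) - 1
      ≤ ∑ m ∈ Finset.range (k + 1), σ m k := fun k => by
    refine le_trans ?_ (ge_of_tendsto (tendsto_finsetSum _ fun m _ => hσlim m k)
      ((eventually_gt_atTop k).filter_mono hU |>.mono fun j hj => hS k j hj))
    gcongr with m hm
    exact hfx m k (Nat.lt_succ_iff.1 (Finset.mem_range.1 hm))
  -- taking `k` so large that the first `M` summands fall short of `N` by `c`
  have key : ∀ M : ℕ, M * c ≤ 2 * (N + 3 / 2) + 1 := fun M => by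
    have h1 : ∀ᶠ k in (hyperfilter ℕ : Filter ℕ), ∀ m ∈ Finset.range M, σ m k < N - c :=
      (Filter.eventually_all_finset _).2 fun m _ => hσsmall m
    obtain ⟨k, hk, hMk⟩ := (h1.and ((eventually_ge_atTop M).filter_mono hU)).exists
    have h2 : ∀ m ∈ Finset.range (k + 1), (if m < M then c else 0)
        ≤ (N - (1 / 4) ^ m) - σ m k + (1 / 2) ^ m * (N + 3 / 2) := fun m hm => by
      have h3 : (1 / 4 : ℝ) ^ m ≤ (1 / 2) ^ m :=
        pow_le_pow_left₀ (by norm_num) (by norm_num) m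
      split_ifs with hmM
      · have h4 : 0 ≤ (1 / 2 : ℝ) ^ m * (N + 1 / 2) := by positivity
        linarith [hk m (Finset.mem_range.2 hmM)]
      · linarith [hσle m k (Nat.lt_succ_iff.1 (Finset.mem_range.1 hm))]
    have h3 : ∑ m ∈ Finset.range (k + 1), (if m < M then c else 0) = M * c := by
      have h : (Finset.range (k + 1)).filter (· < M) = Finset.range M := by
        ext m
        simp only [Finset.mem_filter, Finset.mem_range]
        omega
      rw [← Finset.sum_filter, h, Finset.sum_const, Finset.card_range, nsmul_eq_mul]
    have h4 := Finset.sum_le_sum h2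
    rw [h3, Finset.sum_add_distrib, Finset.sum_sub_distrib, ← Finset.sum_mul] at h4
    have h5 : (∑ m ∈ Finset.range (k + 1), (1 / 2 : ℝ) ^ m) * (N + 3 / 2) ≤ 2 * (N + 3 / 2) := by
      gcongr
      exact sum_geometric_two_le _
    linarith [hσsum k]
  obtain ⟨M, hM⟩ := exists_nat_gt ((2 * (N + 3 / 2) + 1) / c)
  rw [div_lt_iff₀ hc] at hM
  linarith [key M]

end

end AronBerner

theorem mainTheorem9 {𝕜 X Y : Type*} [RCLike 𝕜]
    [NormedAddCommGroup X] [NormedSpace 𝕜 X] [CompleteSpace X]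
    [NormedAddCommGroup Y] [NormedSpace 𝕜 Y] [CompleteSpace Y] :
    Dense {P : AronBerner.HomPoly2 𝕜 X Y |
      AronBerner.AttainsNorm (AronBerner.aronBerner P)} := by
  refine Metric.dense_iff.2 fun P₀ ε hε => ?_
  rcases eq_or_ne P₀ 0 with rfl | hP₀
  · refine ⟨0, Metric.mem_ball_self hε, 0, by simp, ?_⟩
    have h := AronBerner.norm_aronBerner_le (0 : AronBerner.HomPoly2 𝕜 X Y)
    rw [norm_zero] at h
    rw [QuadraticMap.map_zero, norm_zero, le_antisymm h (norm_nonneg _)]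
  · obtain ⟨P, x, f, hP, hx, hf, hfx, hS⟩ := AronBerner.exists_nearly_norming_sequences hP₀
      (half_pos hε) (δ := fun m => (1 / 4) ^ m) (fun m => by positivity)
    exact ⟨P, Metric.mem_ball.2 (hP.trans_lt (half_lt_self hε)),
      AronBerner.attainsNorm_aronBerner_of_sequences hx hf hfx hS⟩
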